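/- For a finite sequence $\alpha=(\alpha_1,\dots,\alpha_d)$ of integers with all $\alpha_i\ge 2$, let $T(\alpha_1,\dots,\alpha_d)$ be the symmetric tridiagonal $d\times d$ matrix with diagonal entries $\alpha_1,\dots,\alpha_d$, with all entries on the sub- and superdiagonal equal to $1$, and with all other entries $0$. This matrix is positive definite; let $\Lambda(\alpha_1,\dots,\alpha_d)$ be the Euclidean lattice of rank $d$ with Gram matrix $T(\alpha_1,\dots,\alpha_d)$, i.e. $\mathbb Z^d$ with the scalar product $\langle x,y\rangle=x^{\mathsf t}\,T(\alpha_1,\dots,\alpha_d)\,y$. Two lattices are isometric if there is a group isomorphism between them which preserves the scalar products. **Theorem.** Let $\alpha_1,\dots,\alpha_d\ge 2$ and $\beta_1,\dots,\beta_e\ge 2$ be integers. The lattices $\Lambda(\alpha_1,\dots,\alpha_d)$ and $\Lambda(\beta_1,\dots,\beta_e)$ are isometric if and only if $d=e$ and either $\alpha_i=\beta_i$ for all $i=1,\dots,d$, or $\alpha_i=\beta_{d+1-i}$ for all $i=1,\dots,d$. -/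

import Mathlib

/-- The symmetric tridiagonal matrix with diagonal `α` and with all entries of the sub- and
superdiagonal equal to one. -/
def tridiag {d : ℕ} (α : Fin d → ℤ) : Matrix (Fin d) (Fin d) ℤ :=
  Matrix.of fun i j =>
    if i = j then α i
    else if (i : ℕ) + 1 = j ∨ (j : ℕ) + 1 = i then 1
    else 0

/-- An integral Euclidean lattice: a free `ℤ`-module of finite rank with a symmetric positive
definite scalar product. Since the scalar product takes integral values, positive definiteness
on the module is the same as positive definiteness on its real span. -/
structure EuclideanLattice where
  carrier : Type
  [addCommGroup : AddCommGroup carrier]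
  [free : Module.Free ℤ carrier]
  [finite : Module.Finite ℤ carrier]
  form : LinearMap.BilinForm ℤ carrier
  symm : ∀ x y, form x y = form y x
  posDef : ∀ x, x ≠ 0 → 0 < form x x

attribute [instance] EuclideanLattice.addCommGroup EuclideanLattice.free EuclideanLattice.finite

/-- Two lattices are isometric (isomorphic as Euclidean lattices) if some isomorphism of the
underlying groups preserves the scalar product. -/
def EuclideanLattice.Isometric (L M : EuclideanLattice) : Prop :=
  ∃ e : L.carrier ≃ₗ[ℤ] M.carrier, ∀ x y : L.carrier, M.form (e x) (e y) = L.form x y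

theorem tridiag_symm {d : ℕ} (α : Fin d → ℤ) (i j : Fin d) :
    tridiag α i j = tridiag α j i := by
  simp only [tridiag, Matrix.of_apply]
  by_cases h : i = j
  · simp [h]
  · simp [h, Ne.symm h, or_comm]

theorem tridiag_form {d : ℕ} (α : Fin d → ℤ) (x y : Fin d → ℤ) :
    Matrix.toBilin' (tridiag α) x y = ∑ i, ∑ j, x i * tridiag α i j * y j :=
  Matrix.toBilin'_apply _ _ _

theorem tridiag_form_symm {d : ℕ} (α : Fin d → ℤ) (x y : Fin d → ℤ) :
    Matrix.toBilin' (tridiag α) x y = Matrix.toBilin' (tridiag α) y x := by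
  rw [tridiag_form, tridiag_form, Finset.sum_comm]
  refine Finset.sum_congr rfl fun i _ => Finset.sum_congr rfl fun j _ => ?_
  rw [tridiag_symm α j i]
  ring

theorem tridiag_form_succ {d : ℕ} (α x : Fin (d + 2) → ℤ) :
    Matrix.toBilin' (tridiag α) x x = α 0 * x 0 ^ 2 + 2 * x 0 * x 1 +
      Matrix.toBilin' (tridiag fun i => α i.succ) (fun i => x i.succ) (fun i => x i.succ) := by
  have h00 : tridiag α 0 0 = α 0 := by simp [tridiag]
  have h01 : ∀ j : Fin (d + 1), tridiag α 0 j.succ = if j = 0 then 1 else 0 := by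
    intro j
    by_cases hj : j = 0
    · simp [tridiag, hj]
    · simp [tridiag, hj, (Fin.succ_ne_zero j).symm]
  have h11 : ∀ i j : Fin (d + 1),
      tridiag α i.succ j.succ = tridiag (fun i => α i.succ) i j := by
    intro i j
    simp [tridiag]
  rw [tridiag_form, tridiag_form, Fin.sum_univ_succ]
  simp only [Fin.sum_univ_succ (fun j => x _ * tridiag α _ j * x j), tridiag_symm α _ 0, h00,
    h01, h11, Finset.sum_add_distrib]
  simp only [mul_ite, ite_mul, mul_one, mul_zero, zero_mul, Finset.sum_ite_eq',
    Finset.mem_univ, if_true, Fin.succ_zero_eq_one]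
  ring

theorem tridiag_form_bound {d : ℕ} (α : Fin (d + 1) → ℤ) (hα : ∀ i, 2 ≤ α i)
    (x : Fin (d + 1) → ℤ) :
    x 0 ^ 2 ≤ Matrix.toBilin' (tridiag α) x x ∧
      (Matrix.toBilin' (tridiag α) x x = 0 → x = 0) := by
  induction d with
  | zero =>
    have h : Matrix.toBilin' (tridiag α) x x = α 0 * x 0 ^ 2 := by
      rw [tridiag_form]
      simp [tridiag]
      ring
    rw [h]
    have h2 := hα 0
    refine ⟨by nlinarith [sq_nonneg (x 0)], fun h0 => ?_⟩
    have hx : x 0 = 0 := by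
      have : x 0 ^ 2 ≤ 0 := by nlinarith [sq_nonneg (x 0)]
      exact (pow_eq_zero_iff two_ne_zero).1 (le_antisymm this (sq_nonneg _))
    funext i
    rw [show i = 0 from Fin.ext (by simp), hx]
    rfl
  | succ d ih =>
    obtain ⟨h1, h2⟩ := ih (fun i => α i.succ) (fun i => hα _) (fun i => x i.succ)
    rw [tridiag_form_succ]
    simp only [Fin.succ_zero_eq_one] at h1
    have ha := hα 0
    have hm : 2 * x 0 ^ 2 ≤ α 0 * x 0 ^ 2 := mul_le_mul_of_nonneg_right ha (sq_nonneg _)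
    have hs := sq_nonneg (x 0 + x 1)
    refine ⟨by nlinarith, fun h0 => ?_⟩
    have hx : x 0 = 0 := by
      have : x 0 ^ 2 ≤ 0 := by nlinarith
      exact (pow_eq_zero_iff two_ne_zero).1 (le_antisymm this (sq_nonneg _))
    have ht := h2 (by rw [hx] at h0; linarith)
    funext i
    refine Fin.cases hx (fun j => ?_) i
    exact congrFun ht j

theorem tridiag_form_pos {d : ℕ} (α : Fin d → ℤ) (hα : ∀ i, 2 ≤ α i) (x : Fin d → ℤ)
    (hx : x ≠ 0) : 0 < Matrix.toBilin' (tridiag α) x x := by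
  cases d with
  | zero => exact absurd (Subsingleton.elim x 0) hx
  | succ d =>
    obtain ⟨h1, h2⟩ := tridiag_form_bound α hα x
    exact lt_of_le_of_ne ((sq_nonneg _).trans h1) fun h => hx (h2 h.symm)

/-- The lattice of type T with diagonal sequence `α`: the module `ℤ ^ d` with the scalar product
for which the Gram matrix of the standard basis is `tridiag α`. -/
def latticeT {d : ℕ} (α : Fin d → ℤ) (hα : ∀ i, 2 ≤ α i) : EuclideanLattice where
  carrier := Fin d → ℤ
  form := Matrix.toBilin' (tridiag α)
  symm := tridiag_form_symm α
  posDef := tridiag_form_pos α hα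

/-!
Up to alternating signs of the coordinates, the scalar product of a lattice of type T is the
Dirichlet form of a path on `d + 2` vertices, plus the nonnegative potential `α k - 2`, on functions
vanishing at both ends (`toBilin_tridiag_eq_energy`). This exhibits its irreducible vectors, those
which are not sums of two nonzero vectors with nonnegative scalar product: they are plus or minus
the indicator functions of the nonempty intervals (`intervalRoot_isIrreducible`,
`exists_eq_intervalRoot`). An interval is given by its two end points, and the increment of its
indicator function is a difference of two standard basis vectors, so the irreducible vectors form a
root system of type `A_d`, indexed by the ordered pairs of distinct elements of `{0, …, d}`.

An isometry preserves irreducibility, hence maps roots to roots, and therefore is given, up to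
sign, by a permutation `σ` of `{0, …, d}` (`exists_index_map`). The norm of the root with indices
`i ≠ j` is `2 + |s i - s j|`, where `s p` is the sum of `α k - 2` over `k < p`
(`toBilin_intervalRoot_self`). So `σ` is distance preserving between the two configurations `s` of
points on the line. Both are listed in increasing order, so they agree up to a translation or a
reflection (`eq_or_reflect_of_dist`), and their consecutive differences are the sequences `α k - 2`
and `β k - 2`, which are thus equal or reverses of each other.
-/

/-! ### The scalar product as an energy -/

open Finset in
/-- The energy of a pair of functions on `{0, …, d + 1}`: the Dirichlet form of the path plus a
potential `α k - 2` at the vertex `k + 1`. -/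
def energy {d : ℕ} (α : Fin d → ℤ) (Y W : ℕ → ℤ) : ℤ :=
  ∑ n ∈ range (d + 1), (Y (n + 1) - Y n) * (W (n + 1) - W n) +
    ∑ k : Fin d, (α k - 2) * (Y (k + 1) * W (k + 1))

/-- The height function of a vector: its coordinates with alternating signs, shifted by one and
extended by zero to all of `ℕ`. The signs turn the off-diagonal entries of `tridiag α` into
`-1`. -/
def height {d : ℕ} : (Fin d → ℤ) →ₗ[ℤ] (ℕ → ℤ) where
  toFun x n := if h : 0 < n ∧ n ≤ d then (-1) ^ n * x ⟨n - 1, by omega⟩ else 0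
  map_add' x y := by
    funext n
    by_cases h : 0 < n ∧ n ≤ d <;> simp [h, mul_add]
  map_smul' c x := by
    funext n
    by_cases h : 0 < n ∧ n ≤ d
    · simp [h]; ring
    · simp [h]

theorem height_zero_right {d : ℕ} (x : Fin d → ℤ) : height x 0 = 0 := by simp [height]

theorem height_of_lt {d : ℕ} (x : Fin d → ℤ) {n : ℕ} (h : d < n) : height x n = 0 := by
  simp [height, h]

theorem height_succ {d : ℕ} (x : Fin d → ℤ) (k : Fin d) :
    height x (k + 1) = (-1) ^ (k + 1 : ℕ) * x k := by
  have := k.isLt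
  simp [height]

theorem height_injective {d : ℕ} : Function.Injective (height (d := d)) := by
  intro x y h
  funext k
  have := congrFun h (k + 1)
  rw [height_succ, height_succ] at this
  exact mul_left_cancel₀ (pow_ne_zero _ (by norm_num)) this

open Finset in
/-- Summation by parts for the discrete Laplacian. -/
theorem sum_by_parts (Y W : ℕ → ℤ) (m : ℕ) :
    ∑ n ∈ range m, Y (n + 1) * (2 * W (n + 1) - W n - W (n + 2)) =
      ∑ n ∈ range m, (Y (n + 1) - Y n) * (W (n + 1) - W n) -
        Y m * (W (m + 1) - W m) + Y 0 * (W 1 - W 0) := by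
  induction m with
  | zero => simp
  | succ m ih => rw [sum_range_succ, sum_range_succ, ih]; ring

open Finset in
/-- Up to signs, `tridiag α` acts on height functions as the negative discrete Laplacian plus
the potential `α - 2`. -/
theorem tridiag_row {d : ℕ} (α y : Fin d → ℤ) (i : Fin d) :
    ∑ j, tridiag α i j * y j =
      (-1) ^ (i + 1 : ℕ) *
        (α i * height y (i + 1) - height y i - height y (i + 2)) := by
  have hs : ∀ j, tridiag α i j * y j = (if i = j then α i * y j else 0) +
      ((if (i : ℕ) + 1 = j then y j else 0) + (if (j : ℕ) + 1 = i then y j else 0)) := by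
    intro j
    simp only [tridiag, Matrix.of_apply, Fin.ext_iff]
    split_ifs <;> omega
  have hsq : ((-1 : ℤ) ^ (i : ℕ)) * (-1) ^ (i : ℕ) = 1 := by
    rw [← mul_pow]; simp
  have h1 : ∑ j : Fin d, (if (i : ℕ) + 1 = j then y j else 0) =
      (-1) ^ (i : ℕ) * height y (i + 2) := by
    by_cases h : (i : ℕ) + 1 < d
    · have e : ∀ j : Fin d, (i : ℕ) + 1 = j ↔ (⟨i + 1, h⟩ : Fin d) = j := by
        intro j; simp [Fin.ext_iff]
      have := height_succ y ⟨i + 1, h⟩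
      simp only at this
      simp only [e, sum_ite_eq, mem_univ, if_true]
      rw [this, pow_succ, pow_succ]
      linear_combination (-y ⟨i + 1, h⟩) * hsq
    · rw [height_of_lt y (by omega), mul_zero]
      exact sum_eq_zero fun j _ => if_neg (by omega)
  have h2 : ∑ j : Fin d, (if (j : ℕ) + 1 = i then y j else 0) =
      (-1) ^ (i : ℕ) * height y i := by
    rcases Nat.eq_zero_or_pos (i : ℕ) with h | h
    · rw [h, height_zero_right, mul_zero]
      exact sum_eq_zero fun j _ => if_neg (by omega)
    · obtain ⟨m, hm⟩ : ∃ m, (i : ℕ) = m + 1 := ⟨i - 1, by omega⟩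
      have e : ∀ j : Fin d, (j : ℕ) + 1 = i ↔ (⟨m, by omega⟩ : Fin d) = j := by
        intro j; simp only [Fin.ext_iff]; omega
      have := height_succ y ⟨m, by omega⟩
      simp only [← hm] at this
      simp only [e, sum_ite_eq, mem_univ, if_true]
      rw [this]
      linear_combination (-y ⟨m, by omega⟩) * hsq
  simp only [hs, sum_add_distrib, sum_ite_eq, mem_univ, if_true]
  rw [h1, h2, height_succ, pow_succ]
  linear_combination (-α i * y i) * hsq

open Finset in
/-- In terms of height functions, the scalar product of the lattice is the energy. -/
theorem toBilin_tridiag_eq_energy {d : ℕ} (α x y : Fin d → ℤ) :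
    Matrix.toBilin' (tridiag α) x y = energy α (height x) (height y) := by
  have h1 : Matrix.toBilin' (tridiag α) x y = ∑ k : Fin d, height x (k + 1) *
      (2 * height y (k + 1) - height y k - height y (k + 2)) +
      ∑ k : Fin d, (α k - 2) * (height x (k + 1) * height y (k + 1)) := by
    rw [tridiag_form, ← sum_add_distrib]
    refine sum_congr rfl fun i _ => ?_
    simp only [mul_assoc]
    rw [← mul_sum, tridiag_row, height_succ x]
    ring
  rw [h1, energy, Fin.sum_univ_eq_sum_range (fun n => height x (n + 1) *
      (2 * height y (n + 1) - height y n - height y (n + 2))) d, sum_by_parts,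
    sum_range_succ, height_zero_right, height_of_lt x (Nat.lt_succ_self d)]
  ring

/-! ### Interval vectors -/

/-- The indicator function of `{0, …, p}`. Heights of the form `step j - step i` are, up to sign,
the indicator functions of intervals. -/
def step (p n : ℕ) : ℤ := if n ≤ p then 1 else 0

theorem step_succ_sub (p n : ℕ) : step p (n + 1) - step p n = -if n = p then 1 else 0 := by
  simp only [step]
  split_ifs <;> omega

/-- The vector with height `step j - step i`, for `i j ≤ d`: up to signs of the coordinates, plus
or minus the indicator vector of an interval. The increments of its height are `1` at `i` and
`-1` at `j`, so these vectors form a root system of type `A_d`. -/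
def intervalRoot (d i j : ℕ) : Fin d → ℤ :=
  fun k => (-1) ^ (k + 1 : ℕ) * (step j (k + 1) - step i (k + 1))

theorem height_intervalRoot {d i j : ℕ} (hi : i ≤ d) (hj : j ≤ d) :
    height (intervalRoot d i j) = step j - step i := by
  funext n
  by_cases h : 0 < n ∧ n ≤ d
  · obtain ⟨m, rfl⟩ : ∃ m, n = m + 1 := ⟨n - 1, by omega⟩
    have := height_succ (intervalRoot d i j) ⟨m, by omega⟩
    simp only [intervalRoot] at this
    rw [← mul_assoc, ← mul_pow] at this
    simpa [intervalRoot] using this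
  · have : height (intervalRoot d i j) n = 0 := by simp [height, h]
    rw [this]
    simp only [step, Pi.sub_apply]
    split_ifs <;> omega

theorem intervalRoot_add (d i j k : ℕ) :
    intervalRoot d i j + intervalRoot d j k = intervalRoot d i k := by
  funext n
  simp only [intervalRoot, Pi.add_apply]
  ring

theorem intervalRoot_self (d i : ℕ) : intervalRoot d i i = 0 := by
  funext n
  simp [intervalRoot]

theorem intervalRoot_swap (d i j : ℕ) : -intervalRoot d i j = intervalRoot d j i := by
  funext n
  simp only [intervalRoot, Pi.neg_apply]
  ring

/-- The increment of the height of a root. -/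
theorem height_intervalRoot_increment {d i j : ℕ} (hi : i ≤ d) (hj : j ≤ d) (n : ℕ) :
    height (intervalRoot d i j) (n + 1) - height (intervalRoot d i j) n =
      (if n = i then 1 else 0) - if n = j then 1 else 0 := by
  rw [height_intervalRoot hi hj]
  simp only [Pi.sub_apply]
  linear_combination step_succ_sub j n - step_succ_sub i n

theorem intervalRoot_ne_zero {d i j : ℕ} (hi : i ≤ d) (hj : j ≤ d) (hij : i ≠ j) :
    intervalRoot d i j ≠ 0 := by
  intro h
  have := height_intervalRoot_increment hi hj i
  simp [h, hij] at this

/-! ### Irreducible vectors -/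

/-- A nonzero vector is irreducible if it is not the sum of two nonzero vectors with nonnegative
scalar product. -/
def EuclideanLattice.IsIrreducible (L : EuclideanLattice) (v : L.carrier) : Prop :=
  v ≠ 0 ∧ ∀ x y, v = x + y → 0 ≤ L.form x y → x = 0 ∨ y = 0

theorem EuclideanLattice.IsIrreducible.neg {L : EuclideanLattice} {v : L.carrier}
    (h : L.IsIrreducible v) : L.IsIrreducible (-v) := by
  refine ⟨neg_ne_zero.2 h.1, fun x y hv hxy => ?_⟩
  have := h.2 (-x) (-y) (by rw [← neg_add, ← hv, neg_neg]) (by simpa using hxy)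
  simpa using this

theorem EuclideanLattice.IsIrreducible.map {L M : EuclideanLattice} {v : L.carrier}
    (h : L.IsIrreducible v) (e : L.carrier ≃ₗ[ℤ] M.carrier)
    (he : ∀ x y, M.form (e x) (e y) = L.form x y) : M.IsIrreducible (e v) := by
  refine ⟨fun h0 => h.1 (by simpa using h0), fun x y hv hxy => ?_⟩
  have := h.2 (e.symm x) (e.symm y) (by rw [← map_add, ← hv, e.symm_apply_apply])
    (by rw [← he]; simpa using hxy)
  simpa using this

theorem int_mul_sub_nonpos {t a : ℤ} (h : -1 ≤ t ∧ t ≤ 1) : a * (t - a) ≤ 0 := by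
  obtain ⟨h1, h2⟩ := h
  rcases lt_trichotomy a 0 with ha | rfl | ha
  · exact mul_nonpos_of_nonpos_of_nonneg ha.le (by omega)
  · simp
  · exact mul_nonpos_of_nonneg_of_nonpos ha.le (by omega)

open Finset in
/-- If a root is `x + y`, then every summand of the energy of `x` and `y` has the form `a * (t - a)`
with `t ∈ {-1, 0, 1}`, so is nonpositive. If the energy is nonnegative, all summands vanish, which
leaves only the two trivial choices for `x`. -/
theorem intervalRoot_isIrreducible {d : ℕ} (α : Fin d → ℤ) (hα : ∀ i, 2 ≤ α i) {i j : ℕ}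
    (hi : i ≤ d) (hj : j ≤ d) (hij : i ≠ j) :
    (latticeT α hα).IsIrreducible (intervalRoot d i j) := by
  refine ⟨intervalRoot_ne_zero hi hj hij, fun x y hv hxy => ?_⟩
  change Fin d → ℤ at x y
  change intervalRoot d i j = x + y at hv
  change 0 ≤ Matrix.toBilin' (tridiag α) x y at hxy
  change x = 0 ∨ y = 0
  rw [toBilin_tridiag_eq_energy, energy] at hxy
  have hadd : ∀ n, height y n = (step j n - step i n) - height x n := by
    intro n
    have := congrFun (height_intervalRoot hi hj) n
    rw [hv, map_add] at this
    simp only [Pi.add_apply, Pi.sub_apply] at this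
    linarith
  have hinc : ∀ n, height y (n + 1) - height y n =
      ((if n = i then 1 else 0) - if n = j then 1 else 0) - (height x (n + 1) - height x n) := by
    intro n
    have := height_intervalRoot_increment hi hj n
    rw [hv, map_add] at this
    simp only [Pi.add_apply] at this
    linarith
  have hA : ∀ n ∈ range (d + 1),
      (height x (n + 1) - height x n) * (height y (n + 1) - height y n) ≤ 0 := by
    intro n _
    rw [hinc]
    exact int_mul_sub_nonpos (by split_ifs <;> norm_num)
  have hB : ∑ k : Fin d, (α k - 2) * (height x (k + 1) * height y (k + 1)) ≤ 0 := by
    refine sum_nonpos fun k _ => mul_nonpos_of_nonneg_of_nonpos (by linarith [hα k]) ?_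
    rw [hadd]
    exact int_mul_sub_nonpos (by simp only [step]; split_ifs <;> norm_num)
  have hA0 := (sum_eq_zero_iff_of_nonpos hA).1 (le_antisymm (sum_nonpos hA) (by linarith))
  -- Every increment of `x` is zero or agrees with that of the root.
  have hcase : ∀ n ≤ d, height x (n + 1) = height x n ∨ height x (n + 1) - height x n =
      (if n = i then 1 else 0) - if n = j then 1 else 0 := by
    intro n hn
    rcases mul_eq_zero.1 (hA0 n (by simp; omega)) with h | h
    · left; linarith
    · right; linarith [hinc n]
  have htot : ∀ c : ℤ, (∀ n ≤ d, height x (n + 1) - height x n =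
      c * ((if n = i then 1 else 0) - if n = j then 1 else 0)) →
      ∀ n ≤ d, height x n = c * (step j n - step i n) := by
    intro c hc n
    induction n with
    | zero => intro _; simp [height_zero_right, step]
    | succ n ih =>
      intro hn
      linear_combination hc n (by omega) + ih (by omega) -
        c * (step_succ_sub j n - step_succ_sub i n)
  -- The height is zero at both ends, so `x` has either both jumps of the root or none.
  have hsum : ∑ n ∈ range (d + 1), (height x (n + 1) - height x n) = 0 := by
    rw [sum_range_sub, height_zero_right, height_of_lt x (Nat.lt_succ_self d), sub_zero]
  have hsupp : ∀ n ≤ d, n ≠ i → n ≠ j → height x (n + 1) - height x n = 0 := by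
    intro n hn h1 h2
    rcases hcase n hn with h | h
    · linarith
    · simpa [h1, h2] using h
  have hij0 : (height x (i + 1) - height x i) + (height x (j + 1) - height x j) = 0 := by
    rw [← hsum, ← sum_pair (f := fun n => height x (n + 1) - height x n) hij]
    refine sum_subset ?_ fun n hn hn' => ?_
    · intro n; simp; omega
    · simp only [mem_insert, mem_singleton, not_or] at hn'
      exact hsupp n (by simp at hn; omega) hn'.1 hn'.2
  have hc : ∃ c : ℤ, (c = 0 ∨ c = 1) ∧ ∀ n ≤ d, height x (n + 1) - height x n =
      c * ((if n = i then 1 else 0) - if n = j then 1 else 0) := by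
    refine ⟨height x (i + 1) - height x i, ?_, fun n hn => ?_⟩
    · rcases hcase i hi with h | h
      · left; linarith
      · right; simpa [hij] using h
    · by_cases h1 : n = i
      · subst h1; simp [hij]
      · by_cases h2 : n = j
        · subst h2; simp [h1]; linarith
        · simp [h1, h2, hsupp n hn h1 h2]
  obtain ⟨c, hc01, hc⟩ := hc
  have hx := htot c hc
  have hx' : ∀ n, height x n = c * height (intervalRoot d i j) n := by
    intro n
    by_cases hn : n ≤ d
    · rw [hx n hn, height_intervalRoot hi hj]; rfl
    · rw [height_of_lt x (by omega), height_of_lt _ (by omega), mul_zero]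
  rcases hc01 with rfl | rfl
  · left
    apply height_injective
    funext n
    rw [hx' n, map_zero]; simp
  · right
    have : x = intervalRoot d i j := by
      apply height_injective
      funext n
      rw [hx' n, one_mul]
    rw [this] at hv
    simpa using hv

open Finset in
/-- An irreducible vector whose height is positive somewhere is a root: one can split off the
indicator function of a maximal interval on which the height is positive. -/
theorem exists_eq_intervalRoot_of_pos {d : ℕ} (α : Fin d → ℤ) (hα : ∀ i, 2 ≤ α i)
    {v : Fin d → ℤ} (hv : (latticeT α hα).IsIrreducible v) {m : ℕ} (hm : 0 < height v m) :
    ∃ i j, i ≤ d ∧ j ≤ d ∧ i ≠ j ∧ v = intervalRoot d i j := by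
  have hm0 : m ≠ 0 := by rintro rfl; simp [height_zero_right] at hm
  have hmd : m ≤ d := by
    by_contra h
    simp [height_of_lt v (not_le.1 h)] at hm
  obtain ⟨i, him, hi, hi'⟩ : ∃ i < m, height v i ≤ 0 ∧ ∀ n, i < n → n ≤ m → 0 < height v n := by
    have h0 : height v 0 ≤ 0 := (height_zero_right v).le
    refine ⟨Nat.findGreatest (fun n => height v n ≤ 0) m, ?_, ?_, fun n h1 h2 => ?_⟩
    · refine lt_of_le_of_ne (Nat.findGreatest_le m) fun h => ?_
      have := Nat.findGreatest_spec (P := fun n => height v n ≤ 0) (Nat.zero_le m) h0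
      rw [h] at this
      omega
    · exact Nat.findGreatest_spec (P := fun n => height v n ≤ 0) (Nat.zero_le m) h0
    · exact not_le.1 (Nat.findGreatest_is_greatest h1 h2)
  obtain ⟨j, hmj, hj, hj'⟩ : ∃ j, m ≤ j ∧ height v (j + 1) ≤ 0 ∧
      ∀ n, m ≤ n → n ≤ j → 0 < height v n := by
    have hex : ∃ n, m ≤ n ∧ height v (n + 1) ≤ 0 :=
      ⟨d, hmd, (height_of_lt v (Nat.lt_succ_self d)).le⟩
    refine ⟨Nat.find hex, (Nat.find_spec hex).1, (Nat.find_spec hex).2, fun n h1 h2 => ?_⟩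
    rcases h1.eq_or_lt with rfl | h1
    · exact hm
    · obtain ⟨p, rfl⟩ : ∃ p, n = p + 1 := ⟨n - 1, by omega⟩
      have := Nat.find_min hex (m := p) (by omega)
      by_contra h
      exact this ⟨by omega, by omega⟩
  have hpos : ∀ n, i < n → n ≤ j → 0 < height v n := fun n h1 h2 =>
    (le_total n m).elim (hi' n h1) fun h => hj' n h h2
  have hjd : j ≤ d := by
    by_contra h
    have := hj' j hmj le_rfl
    rw [height_of_lt v (by omega)] at this
    omega
  refine ⟨i, j, by omega, hjd, by omega, ?_⟩
  have hid : i ≤ d := by omega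
  have hw : ∀ n, height (v - intervalRoot d i j) n = height v n - (step j n - step i n) := by
    intro n
    rw [map_sub, height_intervalRoot hid hjd]
    rfl
  have hnn : 0 ≤ Matrix.toBilin' (tridiag α) (intervalRoot d i j) (v - intervalRoot d i j) := by
    rw [toBilin_tridiag_eq_energy, energy]
    refine add_nonneg (sum_nonneg fun n _ => ?_) (sum_nonneg fun k _ =>
      mul_nonneg (by linarith [hα k]) ?_)
    · rw [height_intervalRoot_increment hid hjd, hw, hw]
      by_cases h1 : n = i
      · subst h1
        have := hpos (n + 1) (by omega) (by omega)
        rw [if_pos rfl, if_neg (by omega)]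
        simp only [step]
        split_ifs <;> omega
      · by_cases h2 : n = j
        · subst h2
          have := hpos n (by omega) (by omega)
          rw [if_neg h1, if_pos rfl]
          simp only [step]
          split_ifs <;> omega
        · simp [h1, h2]
    · rw [hw, height_intervalRoot hid hjd]
      simp only [step, Pi.sub_apply]
      have := hpos (k + 1)
      split_ifs <;> omega
  rcases hv.2 (intervalRoot d i j) (v - intervalRoot d i j) (add_sub_cancel _ v).symm hnn with h | h
  · exact absurd h (intervalRoot_ne_zero hid hjd (by omega))
  · exact sub_eq_zero.1 h

theorem exists_eq_intervalRoot {d : ℕ} (α : Fin d → ℤ) (hα : ∀ i, 2 ≤ α i)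
    {v : Fin d → ℤ} (hv : (latticeT α hα).IsIrreducible v) :
    ∃ i j, i ≤ d ∧ j ≤ d ∧ i ≠ j ∧ v = intervalRoot d i j := by
  obtain ⟨m, hm⟩ : ∃ m, height v m ≠ 0 := by
    by_contra! h
    exact hv.1 (height_injective (a₂ := 0) ((funext h).trans (map_zero height).symm))
  rcases hm.lt_or_gt with h | h
  · obtain ⟨i, j, hi, hj, hij, h⟩ := exists_eq_intervalRoot_of_pos α hα (v := -v) hv.neg
      (m := m) (by rw [map_neg]; simpa using h)
    exact ⟨j, i, hj, hi, hij.symm, by rw [← intervalRoot_swap, ← h, neg_neg]⟩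
  · exact exists_eq_intervalRoot_of_pos α hα hv h

/-! ### Maps between the root systems -/

/-- Two roots whose difference is again a root share their first or their second
index. -/
theorem intervalRoot_share {d a b a' b' p q : ℕ} (ha : a ≤ d) (hb : b ≤ d) (ha' : a' ≤ d)
    (hb' : b' ≤ d) (hp : p ≤ d) (hq : q ≤ d) (hab : a ≠ b) (hab' : a' ≠ b')
    (h : intervalRoot d a b - intervalRoot d a' b' = intervalRoot d p q) : a = a' ∨ b = b' := by
  have key : ∀ n, ((if n = a then 1 else 0) - if n = b then 1 else 0) -
      ((if n = a' then 1 else 0) - if n = b' then (1 : ℤ) else 0) =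
      (if n = p then 1 else 0) - if n = q then 1 else 0 := by
    intro n
    have h1 := height_intervalRoot_increment ha hb n
    have h2 := height_intervalRoot_increment ha' hb' n
    have h3 := height_intervalRoot_increment hp hq n
    rw [← h, map_sub] at h3
    simp only [Pi.sub_apply] at h3
    linarith
  have k1 := key a
  have k2 := key b'
  by_contra hcon
  grind

/-- An additive family of roots, indexed by pairs, comes from a map between the indices, up to
sign: the roots `F 0 i` differ pairwise by roots, so they all share their first or all share their
second index. -/
theorem exists_index_map {d e : ℕ} (F : Fin (d + 1) → Fin (d + 1) → Fin e → ℤ)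
    (hadd : ∀ i j k, F i j + F j k = F i k)
    (hroot : ∀ i j, i ≠ j → ∃ a b, a ≤ e ∧ b ≤ e ∧ a ≠ b ∧ F i j = intervalRoot e a b) :
    ∃ τ : Fin (d + 1) → Fin (e + 1), ∀ i j, F i j = intervalRoot e (τ i) (τ j) ∨
      F i j = intervalRoot e (τ j) (τ i) := by
  have hself : ∀ i, F i i = 0 := fun i => by simpa using hadd i i i
  have hsub : ∀ i j, F 0 i - F 0 j = F j i := fun i j => by
    rw [← hadd 0 j i]; abel
  have hroot0 : ∀ i, ∃ a b, a ≤ e ∧ b ≤ e ∧ (i ≠ 0 → a ≠ b ∧ F 0 i = intervalRoot e a b) := by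
    intro i
    by_cases h : i = 0
    · exact ⟨0, 0, by omega, by omega, fun h' => absurd h h'⟩
    · obtain ⟨a, b, ha, hb, h1, h2⟩ := hroot 0 i (Ne.symm h)
      exact ⟨a, b, ha, hb, fun _ => ⟨h1, h2⟩⟩
  choose a b ha hb hF using hroot0
  have hshare : ∀ i j, i ≠ 0 → j ≠ 0 → a i = a j ∨ b i = b j := by
    intro i j hi hj
    by_cases hij : i = j
    · left; rw [hij]
    · obtain ⟨p, q, hp, hq, hpq, h⟩ := hroot j i (Ne.symm hij)
      refine intervalRoot_share (ha i) (hb i) (ha j) (hb j) hp hq (hF i hi).1 (hF j hj).1 ?_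
      rw [← (hF i hi).2, ← (hF j hj).2, hsub, h]
  have hdist : ∀ i j, i ≠ 0 → j ≠ 0 → i ≠ j → ¬ (a i = a j ∧ b i = b j) := by
    rintro i j hi hj hij ⟨h1, h2⟩
    obtain ⟨p, q, hp, hq, hpq, h⟩ := hroot j i (Ne.symm hij)
    refine intervalRoot_ne_zero hp hq hpq ?_
    rw [← h, ← hsub, (hF i hi).2, (hF j hj).2, h1, h2, sub_self]
  -- A family of pairs that pairwise share exactly one entry shares one entry throughout.
  have hall : (∀ i j, i ≠ 0 → j ≠ 0 → a i = a j) ∨ (∀ i j, i ≠ 0 → j ≠ 0 → b i = b j) := by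
    by_contra! h
    obtain ⟨⟨i, j, hi, hj, h1⟩, k, l, hk, hl, h2⟩ := h
    have := hshare i j hi hj
    have := hshare k l hk hl
    have := hshare i k hi hk
    have := hshare i l hi hl
    have := hshare j k hj hk
    have := hshare j l hj hl
    have := hdist i k hi hk
    have := hdist i l hi hl
    have := hdist j k hj hk
    have := hdist j l hj hl
    grind
  by_cases hd : ∃ i₀ : Fin (d + 1), i₀ ≠ 0
  · obtain ⟨i₀, hi₀⟩ := hd
    rcases hall with h | h
    · obtain ⟨τ, hτ⟩ : ∃ τ : Fin (d + 1) → Fin (e + 1), ∀ i,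
          F 0 i = intervalRoot e (a i₀) (τ i) := by
        refine ⟨fun i => if i = 0 then ⟨a i₀, Nat.lt_succ_of_le (ha i₀)⟩ else
          ⟨b i, Nat.lt_succ_of_le (hb i)⟩, fun i => ?_⟩
        by_cases hi : i = 0
        · simp only [hi, if_true]
          rw [hself, intervalRoot_self]
        · simp only [hi, if_false]
          rw [(hF i hi).2, h i i₀ hi hi₀]
      refine ⟨τ, fun i j => Or.inl ?_⟩
      rw [← hsub, hτ, hτ, sub_eq_iff_eq_add', intervalRoot_add]
    · obtain ⟨τ, hτ⟩ : ∃ τ : Fin (d + 1) → Fin (e + 1), ∀ i,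
          F 0 i = intervalRoot e (τ i) (b i₀) := by
        refine ⟨fun i => if i = 0 then ⟨b i₀, Nat.lt_succ_of_le (hb i₀)⟩ else
          ⟨a i, Nat.lt_succ_of_le (ha i)⟩, fun i => ?_⟩
        by_cases hi : i = 0
        · simp only [hi, if_true]
          rw [hself, intervalRoot_self]
        · simp only [hi, if_false]
          rw [(hF i hi).2, h i i₀ hi hi₀]
      refine ⟨τ, fun i j => Or.inr ?_⟩
      rw [← hsub, hτ, hτ, sub_eq_iff_eq_add, intervalRoot_add]
  · push Not at hd
    exact ⟨fun _ => 0, fun i j => Or.inl (by rw [hd i, hd j, hself, intervalRoot_self])⟩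

/-! ### Norms of the roots -/

open Finset in
/-- The partial sums of the sequence `α k - 2`. -/
def excess {d : ℕ} (α : Fin d → ℤ) (p : Fin (d + 1)) : ℤ :=
  ∑ k : Fin d, if (k : ℕ) < p then α k - 2 else 0

theorem excess_monotone {d : ℕ} (α : Fin d → ℤ) (hα : ∀ i, 2 ≤ α i) : Monotone (excess α) := by
  intro p q hpq
  refine Finset.sum_le_sum fun k _ => ?_
  have := hα k
  have : (p : ℕ) ≤ q := hpq
  split_ifs <;> omega

theorem excess_succ_sub {d : ℕ} (α : Fin d → ℤ) (k : Fin d) :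
    excess α k.succ - excess α k.castSucc = α k - 2 := by
  rw [excess, excess, ← Finset.sum_sub_distrib, Finset.sum_eq_single k]
  · simp
  · intro j _ hj
    have : (j : ℕ) ≠ k := fun h => hj (Fin.ext h)
    simp only [Fin.val_succ, Fin.val_castSucc]
    split_ifs <;> omega
  · simp

open Finset in
/-- The norm of a root: the increments contribute `2`, the potential the rest. -/
theorem toBilin_intervalRoot_self {d : ℕ} (α : Fin d → ℤ) (hα : ∀ i, 2 ≤ α i)
    {i j : Fin (d + 1)} (hij : i ≠ j) :
    Matrix.toBilin' (tridiag α) (intervalRoot d i j) (intervalRoot d i j) =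
      2 + |excess α i - excess α j| := by
  have aux : ∀ i j : Fin (d + 1), i < j →
      Matrix.toBilin' (tridiag α) (intervalRoot d i j) (intervalRoot d i j) =
      2 + |excess α i - excess α j| := by
    intro i j hij
    have hij' : (i : ℕ) < j := hij
    have hi : (i : ℕ) ≤ d := by omega
    have hj : (j : ℕ) ≤ d := by omega
    rw [abs_sub_comm, abs_of_nonneg (sub_nonneg.2 (excess_monotone α hα hij.le)),
      toBilin_tridiag_eq_energy, energy]
    congr 1
    · simp only [height_intervalRoot_increment hi hj]
      rw [← sum_subset (s₁ := {(i : ℕ), (j : ℕ)}), sum_pair (by omega)]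
      · rw [if_pos rfl, if_pos rfl, if_neg (by omega), if_neg (by omega)]; norm_num
      · intro n; simp; omega
      · intro n _ hn
        simp only [mem_insert, mem_singleton, not_or] at hn
        simp [hn.1, hn.2]
    · rw [excess, excess, ← sum_sub_distrib]
      refine sum_congr rfl fun k _ => ?_
      rw [height_intervalRoot hi hj]
      simp only [step, Pi.sub_apply, Nat.succ_le_iff]
      split_ifs <;> omega
  rcases hij.lt_or_gt with h | h
  · exact aux i j h
  · rw [← intervalRoot_swap, abs_sub_comm, ← aux j i h]
    simp

/-! ### Point configurations on a line -/

/-- Monotone tuples that agree up to a permutation are equal. -/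
theorem monotone_eq_of_comp_perm {n : ℕ} {s t : Fin n → ℤ} (hs : Monotone s) (ht : Monotone t)
    (σ : Equiv.Perm (Fin n)) (h : t ∘ σ = s) : s = t := by
  have h1 := Tuple.comp_sort_eq_comp_iff_monotone (f := t) (σ := σ)
  have h2 := Tuple.comp_sort_eq_comp_iff_monotone (f := t) (σ := 1)
  have h3 := h1.2 (by rw [h]; exact hs)
  have h4 := h2.2 (by simpa using ht)
  rw [← h, h3, ← h4]
  rfl

/-- A finite configuration of points on a line is determined by its distances, up to translation
and reflection. -/
theorem eq_or_reflect_of_dist {n : ℕ} {s t : Fin (n + 1) → ℤ} (hs : Monotone s) (ht : Monotone t)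
    (σ : Equiv.Perm (Fin (n + 1))) (h : ∀ i j, |s i - s j| = |t (σ i) - t (σ j)|) :
    ∃ c, (∀ i, t i = s i + c) ∨ (∀ i, t i = c - s i.rev) := by
  have hlast := h (Fin.last n) 0
  have hk : ∀ k, s 0 ≤ s k ∧ s k ≤ s (Fin.last n) := fun k =>
    ⟨hs (Fin.zero_le k), hs (Fin.le_last k)⟩
  -- The extreme points of `s` are farthest apart, and every other point lies between them.
  have hcase : (∀ k, t (σ k) = s k + (t (σ 0) - s 0)) ∨ (∀ k, t (σ k) = t (σ 0) + s 0 - s k) := by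
    rcases le_total (t (σ 0)) (t (σ (Fin.last n))) with hle | hle
    · left; intro k
      have := h k 0
      have := h (Fin.last n) k
      have := hk k
      grind
    · right; intro k
      have := h k 0
      have := h (Fin.last n) k
      have := hk k
      grind
  rcases hcase with hc | hc
  · refine ⟨t (σ 0) - s 0, Or.inl fun i => ?_⟩
    have := monotone_eq_of_comp_perm (s := fun i => s i + (t (σ 0) - s 0))
      (fun i j hij => by have := hs hij; simp only; omega) ht σ (funext hc)
    exact (congrFun this i).symm
  · refine ⟨t (σ 0) + s 0, Or.inr fun i => ?_⟩
    have := monotone_eq_of_comp_perm (s := fun i => t (σ 0) + s 0 - s i.rev)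
      (fun i j hij => by have := hs (Fin.rev_le_rev.2 hij); simp only; omega) ht
      (Fin.revPerm.trans σ) (funext fun i => by simpa using hc i.rev)
    exact (congrFun this i).symm

/-! ### Classification -/

theorem latticeT_isometric_rev {d : ℕ} (α β : Fin d → ℤ) (hα : ∀ i, 2 ≤ α i)
    (hβ : ∀ i, 2 ≤ β i) (h : ∀ i, α i = β i.rev) :
    (latticeT α hα).Isometric (latticeT β hβ) := by
  refine ⟨LinearEquiv.funCongrLeft ℤ ℤ Fin.revPerm, fun x y => ?_⟩
  change Fin d → ℤ at x y
  change Matrix.toBilin' (tridiag β) (fun i => x i.rev) (fun i => y i.rev) =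
    Matrix.toBilin' (tridiag α) x y
  have ht : ∀ i j : Fin d, tridiag β i j = tridiag α i.rev j.rev := by
    intro i j
    simp only [tridiag, Matrix.of_apply, h, Fin.rev_rev, Fin.rev_inj, Fin.val_rev]
    congr 1
    exact if_congr (by omega) rfl rfl
  rw [tridiag_form, tridiag_form, ← Equiv.sum_comp Fin.revPerm]
  refine Finset.sum_congr rfl fun i _ => ?_
  rw [← Equiv.sum_comp Fin.revPerm]
  refine Finset.sum_congr rfl fun j _ => ?_
  simp [ht]

theorem theorem6p3 {d e : ℕ} (α : Fin d → ℤ) (β : Fin e → ℤ)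
    (hα : ∀ i, 2 ≤ α i) (hβ : ∀ i, 2 ≤ β i) :
    (latticeT α hα).Isometric (latticeT β hβ) ↔
      ∃ h : d = e,
        (∀ i : Fin d, α i = β (Fin.cast h i)) ∨
        (∀ i : Fin d, α i = β (Fin.cast h i.rev)) := by
  constructor
  · rintro ⟨f, hf⟩
    change (Fin d → ℤ) ≃ₗ[ℤ] (Fin e → ℤ) at f
    change ∀ x y : Fin d → ℤ, Matrix.toBilin' (tridiag β) (f x) (f y) =
      Matrix.toBilin' (tridiag α) x y at hf
    obtain rfl : d = e := by simpa using f.finrank_eq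
    refine ⟨rfl, ?_⟩
    obtain ⟨τ, hτ⟩ := exists_index_map (fun i j : Fin (d + 1) => f (intervalRoot d i j))
      (fun i j k => by rw [← map_add, intervalRoot_add])
      (fun i j hij => exists_eq_intervalRoot β hβ <|
        EuclideanLattice.IsIrreducible.map (L := latticeT α hα) (M := latticeT β hβ)
          (intervalRoot_isIrreducible α hα (i := i) (j := j) (by omega) (by omega)
            (fun h => hij (Fin.ext h))) f hf)
    have hinj : Function.Injective τ := by
      intro i j hij
      by_contra hne
      refine intervalRoot_ne_zero (d := d) (i := i) (j := j) (by omega) (by omega)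
        (fun h => hne (Fin.ext h)) (f.injective ?_)
      rw [map_zero]
      rcases hτ i j with h | h <;> rw [h, hij, intervalRoot_self]
    let σ : Equiv.Perm (Fin (d + 1)) :=
      Equiv.ofBijective τ (Finite.injective_iff_bijective.1 hinj)
    have hdist : ∀ i j, |excess α i - excess α j| = |excess β (σ i) - excess β (σ j)| := by
      intro i j
      by_cases hij : i = j
      · simp [hij]
      have hne : τ i ≠ τ j := fun h => hij (hinj h)
      have h1 := hf (intervalRoot d i j) (intervalRoot d i j)
      rw [toBilin_intervalRoot_self α hα hij] at h1
      change _ = |excess β (τ i) - excess β (τ j)|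
      rcases hτ i j with h | h
      · rw [h, toBilin_intervalRoot_self β hβ hne] at h1
        linarith
      · rw [h, toBilin_intervalRoot_self β hβ hne.symm, abs_sub_comm] at h1
        linarith
    obtain ⟨c, hc | hc⟩ := eq_or_reflect_of_dist (excess_monotone α hα) (excess_monotone β hβ)
      σ hdist
    · left
      intro k
      have h1 := excess_succ_sub α k
      have h2 := excess_succ_sub β k
      rw [hc, hc] at h2
      simp only [Fin.cast_eq_self]
      linarith
    · right
      intro k
      have h1 := excess_succ_sub α k
      have h2 := excess_succ_sub β k.rev
      rw [hc, hc, Fin.rev_succ, Fin.rev_castSucc, Fin.rev_rev] at h2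
      simp only [Fin.cast_eq_self]
      linarith
  · rintro ⟨rfl, h | h⟩
    · obtain rfl : α = β := funext h
      exact ⟨LinearEquiv.refl ℤ _, fun x y => rfl⟩
    · exact latticeT_isometric_rev α β hα hβ h
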